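/- Let $\mathcal A$ be a finite set with the discrete topology and let $\eta\colon\mathbb Z^2\to\mathcal A$. Give $\mathcal A^{\mathbb Z^2}$ the product topology, let $(T^{u}x)(v):=x(v+u)$ for $u,v\in\mathbb Z^2$ and $x\in\mathcal A^{\mathbb Z^2}$, let $X_\eta:=\overline{\{T^{u}\eta : u\in\mathbb Z^2\}}$, and let $d$ be any metric on $X_\eta$ that induces its topology. Let $P_\eta(n,k)$ denote the number of distinct $n\times k$ blocks occurring in $\eta$, that is, the number of distinct restrictions of the functions $T^{u}\eta$, $u\in\mathbb Z^2$, to $\{(x,y)\in\mathbb Z^2 : 0\le x<n,\ 0\le y<k\}$. A linear subspace $V\subseteq\mathbb R^2$ is called expansive if there exist $r>0$ and $\delta>0$ such that whenever $x,y\in X_\eta$ satisfy $d(T^{u}x,T^{u}y)<\delta$ for all $u\in\mathbb Z^2$ whose Euclidean distance to $V$ is less than $r$, then $x=y$; otherwise $V$ is called nonexpansive. A period vector of $\eta$ is a vector $m\in\mathbb Z^2$ such that $\eta(v+m)=\eta(v)$ for all $v\in\mathbb Z^2$; $\eta$ is periodic if it has a nonzero period vector, and doubly periodic if it has two linearly independent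 period vectors. **Theorem 1.3.** Suppose that there exist integers $n,k\ge 1$ such that $P_\eta(n,k)\le nk$, and that there is exactly one nonexpansive $1$-dimensional subspace $L$ of $\mathbb R^2$. Then $\eta$ is periodic but not doubly periodic, $L$ is a rational line through the origin (that is, $L$ is spanned by a nonzero vector of $\mathbb Z^2$), and every period vector of $\eta$ lies in $L$. -/

import Mathlib

open SymbolicDynamics.FullShift

/-- The inclusion of `ℤ²` into the Euclidean plane. -/
def toPlane (u : ℤ × ℤ) : EuclideanSpace ℝ (Fin 2) := !₂[(u.1 : ℝ), (u.2 : ℝ)]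

/-- The `ℤ²`-orbit `{T^u η : u ∈ ℤ²}` of a configuration, where `(T^u η)(x) = η(u + x)`. -/
def shiftOrbit {A : Type*} (η : ℤ × ℤ → A) : Set (ℤ × ℤ → A) :=
  Set.range fun u : ℤ × ℤ => shift u η

/-- `X_η`, the closure of the orbit of `η` in the product topology on `A^(ℤ²)`. -/
def orbitClosure {A : Type*} [TopologicalSpace A] (η : ℤ × ℤ → A) : Set (ℤ × ℤ → A) :=
  closure (shiftOrbit η)

theorem mapsTo_shift_orbitClosure {A : Type*} [TopologicalSpace A] (η : ℤ × ℤ → A) (u : ℤ × ℤ) :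
    Set.MapsTo (shift (A := A) u) (orbitClosure η) (orbitClosure η) := by
  refine Set.MapsTo.closure ?_ (continuous_shift u)
  rintro _ ⟨v, rfl⟩
  exact ⟨v + u, shift_add v u η⟩

/-- The translation action `u ↦ T^u` of `ℤ²` on `X_η`. -/
def orbitClosureShift {A : Type*} [TopologicalSpace A] (η : ℤ × ℤ → A) (u : ℤ × ℤ) :
    orbitClosure η → orbitClosure η :=
  (mapsTo_shift_orbitClosure η u).restrict

/-- The set `{(T^u η)|_S : u ∈ ℤ²}` of `η`-colorings of `S`. -/
def colorings {A : Type*} (η : ℤ × ℤ → A) (S : Set (ℤ × ℤ)) : Set (S → A) :=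
  Set.range fun u : ℤ × ℤ => S.domRestrict (shift u η)

/-- The rectangle `R_{n,k} = {(x, y) ∈ ℤ² : 0 ≤ x < n, 0 ≤ y < k}`. -/
def rectangle (n k : ℕ) : Set (ℤ × ℤ) :=
  {p | 0 ≤ p.1 ∧ p.1 < n ∧ 0 ≤ p.2 ∧ p.2 < k}

/-- `P_η(n, k)`, the number of distinct `n × k` blocks occurring in `η`. It is used only for a
finite alphabet, where the set of blocks is finite. -/
noncomputable def blockComplexity {A : Type*} (η : ℤ × ℤ → A) (n k : ℕ) : ℕ :=
  (colorings η (rectangle n k)).ncard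

/-- A subspace `V` of `ℝ²` is expansive for a family `T` of self-maps of a metric space `X`
indexed by `ℤ²` if there are an expansiveness radius `r > 0` and an expansiveness constant `δ > 0`
such that `d(T^u x, T^u y) < δ` for all `u` with `d(u, V) < r` implies `x = y`. -/
def IsExpansiveSubspace {X : Type*} [MetricSpace X] (T : ℤ × ℤ → X → X)
    (V : Submodule ℝ (EuclideanSpace ℝ (Fin 2))) : Prop :=
  ∃ r > (0 : ℝ), ∃ δ > (0 : ℝ), ∀ x y : X,
    (∀ u : ℤ × ℤ, Metric.infDist (toPlane u) (V : Set (EuclideanSpace ℝ (Fin 2))) < r →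
      dist (T u x) (T u y) < δ) →
    x = y

/-- A nonexpansive `1`-dimensional subspace of `ℝ²`. -/
def IsNonexpansiveLine {X : Type*} [MetricSpace X] (T : ℤ × ℤ → X → X)
    (V : Submodule ℝ (EuclideanSpace ℝ (Fin 2))) : Prop :=
  Module.finrank ℝ V = 1 ∧ ¬ IsExpansiveSubspace T V

/-- `m` satisfies `η(n + m) = η(n)` for all `n`; the zero vector is allowed here. -/
def IsPeriodVector {A : Type*} (η : ℤ × ℤ → A) (m : ℤ × ℤ) : Prop :=
  ∀ n : ℤ × ℤ, η (n + m) = η n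

/-- `η` has a nonzero period vector. -/
def IsPeriodic {A : Type*} (η : ℤ × ℤ → A) : Prop :=
  ∃ m : ℤ × ℤ, m ≠ 0 ∧ IsPeriodVector η m

/-- `η` has two non-commensurate (linearly independent) period vectors. -/
def IsDoublyPeriodic {A : Type*} (η : ℤ × ℤ → A) : Prop :=
  ∃ m₁ m₂ : ℤ × ℤ, IsPeriodVector η m₁ ∧ IsPeriodVector η m₂ ∧ LinearIndependent ℤ ![m₁, m₂]

/-- A rational line through the origin: a line spanned by a nonzero integer vector. -/
def IsRationalLine (V : Submodule ℝ (EuclideanSpace ℝ (Fin 2))) : Prop :=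
  ∃ v : ℤ × ℤ, v ≠ 0 ∧ V = Submodule.span ℝ {toPlane v}

/-!
Write `Determines η W` if the pattern of `η` on `u + W` determines `η u`, by the same rule for all
`u`. The whole argument is about such finite windows `W`.

Encode the symbols as rational numbers. If there are at most `nk` blocks of size `n × k`, then
some nonzero vector of length `nk + 1` is orthogonal to all vectors `(block, 1)`, so the symbols
of `η` satisfy a linear relation `∑ f s • η (u + s) = const` for all `u`. Solving it for the
symbol at any point `a` of its support `S` gives the window `(S \ {a}) - a`
(`exists_finset_determines_of_blockComplexity_le`).

Two-sided windows make a line expansive (`isExpansiveSubspace_of_determines`): if `θ` is a linear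
form with kernel `L`, and there are windows in `θ < 0` and in `θ > 0`, then agreement on a wide
strip along `L` spreads to the whole plane. As `L` is nonexpansive, `θ` is not injective on `S`:
otherwise its largest and smallest values on `S` would give such windows. So `L` contains an
integer vector `v ≠ 0`. A period vector `m` outside `L` would give the windows `{m}` and `{-m}`,
so all period vectors lie in `L`. In particular `η` is not doubly periodic.

For periodicity, use the coordinates `σ = ⟨v, ·⟩` along `L` and `τ = v × ·` across `L`. The kernel
of `σ + t τ` is not `L`, hence it is expansive, and by compactness of the orbit closure there is a
finite window in the half-plane `σ + t τ < 0` (`exists_determines_of_isExpansiveSubspace`). For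
slopes `t` in a compact interval these windows are uniformly bounded and have a uniform margin.
For steep slopes, the points of `S` that are maximal first for `τ`, respectively `-τ`, and then
for `σ` give two windows that work for all large positive, respectively negative, `t`. Therefore, in a wide enough strip
`|τ| ≤ h` and for `N` large, every point has a window inside the strip on which `N σ + τ ^ 2`
takes smaller values than at the point (`exists_strip_windows`). By induction on this function,
the pattern in a finite box of the strip determines the strip to the right of the box
(`eq_of_eq_on_box`). So the pattern in the box evolves deterministically under translation by `v`,
and by the pigeonhole principle it becomes periodic after at most `M` steps with period dividing
`M!`, where `M` is the number of patterns. As `M` does not depend on the starting point, `M! • v`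
is a period vector of `η`.
-/

/-! ### Windows and compactness -/

/-- A finite window `W` determines `η` if the pattern of `η` on the translate `u + W` determines
the symbol of `η` at `u`, by a rule that does not depend on `u`. -/
def Determines {A : Type*} (η : ℤ × ℤ → A) (W : Finset (ℤ × ℤ)) : Prop :=
  ∀ u v : ℤ × ℤ, (∀ w ∈ W, η (u + w) = η (v + w)) → η u = η v

section Compactness

variable {A : Type*} [TopologicalSpace A] [DiscreteTopology A]

theorem exists_finset_ne_of_isClosed {Y : Type*} [TopologicalSpace Y] [CompactSpace Y]
    {K : Set (Y × Y)} (hK : IsClosed K) {e : Y → ℤ × ℤ → A} (he : Continuous e) {H : Set (ℤ × ℤ)}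
    (h : ∀ p ∈ K, ∃ u ∈ H, e p.1 u ≠ e p.2 u) :
    ∃ W : Finset (ℤ × ℤ), (∀ u ∈ W, u ∈ H) ∧ ∀ p ∈ K, ∃ u ∈ W, e p.1 u ≠ e p.2 u := by
  obtain ⟨b, hbH, hb, hcov⟩ := hK.isCompact.elim_finite_subcover_image (b := H)
    (c := fun u => {p : Y × Y | e p.1 u ≠ e p.2 u})
    (fun u _ => isOpen_ne_fun (by fun_prop) (by fun_prop))
    (fun p hp => by
      obtain ⟨u, hu, hne⟩ := h p hp
      exact Set.mem_biUnion hu hne)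
  refine ⟨hb.toFinset, fun u hu => hbH (by simpa using hu), fun p hp => ?_⟩
  obtain ⟨u, hu, hne⟩ := Set.mem_iUnion₂.1 (hcov hp)
  exact ⟨u, by simpa using hu, hne⟩

theorem isClosed_apply_zero_ne {Y : Type*} [TopologicalSpace Y] {e : Y → ℤ × ℤ → A}
    (he : Continuous e) : IsClosed {p : Y × Y | e p.1 0 ≠ e p.2 0} := by
  have hc : Continuous fun p : Y × Y => (e p.1 0, e p.2 0) := by fun_prop
  exact (isClosed_discrete {q : A × A | q.1 ≠ q.2}).preimage hc

/-- If `D` vanishes on the diagonal, agreement on a large finite set forces `D` to be small. -/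
theorem exists_finset_forall_lt {Y : Type*} [TopologicalSpace Y] [CompactSpace Y]
    {e : Y → ℤ × ℤ → A} (he : Continuous e) (hinj : Function.Injective e) {D : Y × Y → ℝ}
    (hD : Continuous D) (hdiag : ∀ y, D (y, y) = 0) {δ : ℝ} (hδ : 0 < δ) :
    ∃ B : Finset (ℤ × ℤ), ∀ x y : Y, (∀ b ∈ B, e x b = e y b) → D (x, y) < δ := by
  obtain ⟨B, -, hB⟩ := exists_finset_ne_of_isClosed ((isClosed_Ici (a := δ)).preimage hD) he
    (H := Set.univ) (by
      rintro ⟨x, y⟩ hp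
      by_contra! hcon
      obtain rfl : x = y := hinj (funext fun u => hcon u trivial)
      have hp' : δ ≤ D (x, x) := hp
      exact absurd (hdiag x ▸ hp') (not_le.2 hδ))
  refine ⟨B, fun x y hxy => ?_⟩
  by_contra! hlt
  obtain ⟨u, hu, hne⟩ := hB (x, y) hlt
  exact hne (hxy u hu)

/-- If `D` is positive off the diagonal, small `D` forces agreement at the origin. -/
theorem exists_forall_apply_zero_eq {Y : Type*} [TopologicalSpace Y] [CompactSpace Y]
    {e : Y → ℤ × ℤ → A} (he : Continuous e) {D : Y × Y → ℝ}
    (hD : Continuous D) (hpos : ∀ x y, x ≠ y → 0 < D (x, y)) :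
    ∃ δ > 0, ∀ x y : Y, D (x, y) < δ → e x 0 = e y 0 := by
  obtain ⟨δ, hδ, hmin⟩ := (isClosed_apply_zero_ne he).isCompact.exists_forall_le'
    (f := D) (a := 0) hD.continuousOn
    (fun p hp => hpos _ _ fun h => hp (by simp only [h]))
  refine ⟨δ, hδ, fun x y hxy => ?_⟩
  by_contra hne
  exact absurd (hmin (x, y) hne) (not_le.2 hxy)

omit [DiscreteTopology A] in
theorem shift_mem_orbitClosure (η : ℤ × ℤ → A) (u : ℤ × ℤ) : shift u η ∈ orbitClosure η :=
  subset_closure ⟨u, rfl⟩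

theorem exists_shift_eq_on_finset {η x : ℤ × ℤ → A} (hx : x ∈ orbitClosure η)
    (F : Finset (ℤ × ℤ)) : ∃ u, ∀ p ∈ F, x p = η (u + p) := by
  have hopen : IsOpen {y : ℤ × ℤ → A | ∀ p ∈ F, y p = x p} := by
    have : {y : ℤ × ℤ → A | ∀ p ∈ F, y p = x p} = (F : Set (ℤ × ℤ)).pi fun p => {x p} := by
      ext y; simp [Set.mem_pi]
    rw [this]
    exact isOpen_set_pi F.finite_toSet fun p _ => isOpen_discrete _
  obtain ⟨_, hy, u, rfl⟩ := mem_closure_iff.1 hx _ hopen fun p _ => rfl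
  exact ⟨u, fun p hp => (hy p hp).symm⟩

theorem Determines.apply_zero_eq {η : ℤ × ℤ → A} {W : Finset (ℤ × ℤ)} (hW : Determines η W)
    {x y : ℤ × ℤ → A} (hx : x ∈ orbitClosure η) (hy : y ∈ orbitClosure η)
    (h : ∀ w ∈ W, x w = y w) : x 0 = y 0 := by
  classical
  obtain ⟨u, hu⟩ := exists_shift_eq_on_finset hx (insert 0 W)
  obtain ⟨v, hv⟩ := exists_shift_eq_on_finset hy (insert 0 W)
  rw [hu 0 (by simp), hv 0 (by simp), add_zero, add_zero]
  refine hW u v fun w hw => ?_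
  rw [← hu w (by simp [hw]), ← hv w (by simp [hw]), h w hw]

theorem Determines.apply_eq {η : ℤ × ℤ → A} {W : Finset (ℤ × ℤ)} (hW : Determines η W)
    {x y : ℤ × ℤ → A} (hx : x ∈ orbitClosure η) (hy : y ∈ orbitClosure η) (u : ℤ × ℤ)
    (h : ∀ w ∈ W, x (u + w) = y (u + w)) : x u = y u := by
  have := hW.apply_zero_eq (mapsTo_shift_orbitClosure η u hx) (mapsTo_shift_orbitClosure η u hy) h
  simpa [shift] using this

omit [DiscreteTopology A] in
theorem compactSpace_orbitClosure [Finite A] (η : ℤ × ℤ → A) : CompactSpace (orbitClosure η) :=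
  isCompact_iff_compactSpace.1 isClosed_closure.isCompact

/-- If, within the orbit closure, the symbol at the origin is a function of the symbols on `H`,
then it is a function of the symbols on a finite part of `H`. -/
theorem exists_determines_of_forall_eq [Finite A] {η : ℤ × ℤ → A} {H : Set (ℤ × ℤ)}
    (h : ∀ x ∈ orbitClosure η, ∀ y ∈ orbitClosure η, (∀ u ∈ H, x u = y u) → x 0 = y 0) :
    ∃ W : Finset (ℤ × ℤ), Determines η W ∧ ∀ w ∈ W, w ∈ H := by
  have := compactSpace_orbitClosure η
  obtain ⟨W, hWH, hW⟩ := exists_finset_ne_of_isClosed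
    (isClosed_apply_zero_ne (Y := orbitClosure η) continuous_subtype_val)
    continuous_subtype_val (H := H)
    (fun p hp => by
      by_contra! hcon
      exact hp (h _ p.1.2 _ p.2.2 hcon))
  refine ⟨W, fun u v huv => ?_, hWH⟩
  by_contra hne
  obtain ⟨w, hw, hne'⟩ := hW (⟨_, shift_mem_orbitClosure η u⟩, ⟨_, shift_mem_orbitClosure η v⟩)
    (by simpa [shift] using hne)
  exact hne' (huv w hw)

omit [DiscreteTopology A] in
theorem continuous_dist_orbitClosure {η : ℤ × ℤ → A} [d : MetricSpace (orbitClosure η)]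
    (hd : d.toPseudoMetricSpace.toUniformSpace.toTopologicalSpace = instTopologicalSpaceSubtype) :
    @Continuous _ _ (@instTopologicalSpaceProd _ _ instTopologicalSpaceSubtype
      instTopologicalSpaceSubtype) _
      (fun p : orbitClosure η × orbitClosure η => dist p.1 p.2) := by
  rw [← hd]
  exact continuous_dist

theorem exists_finset_dist_lt [Finite A] {η : ℤ × ℤ → A} [d : MetricSpace (orbitClosure η)]
    (hd : d.toPseudoMetricSpace.toUniformSpace.toTopologicalSpace = instTopologicalSpaceSubtype)
    {δ : ℝ} (hδ : 0 < δ) :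
    ∃ B : Finset (ℤ × ℤ), ∀ x y : orbitClosure η, (∀ b ∈ B, x.1 b = y.1 b) → dist x y < δ :=
  @exists_finset_forall_lt A _ _ _ instTopologicalSpaceSubtype (compactSpace_orbitClosure η) _
    continuous_subtype_val Subtype.val_injective _ (continuous_dist_orbitClosure hd) dist_self _ hδ

theorem exists_dist_lt_apply_zero_eq [Finite A] {η : ℤ × ℤ → A}
    [d : MetricSpace (orbitClosure η)]
    (hd : d.toPseudoMetricSpace.toUniformSpace.toTopologicalSpace = instTopologicalSpaceSubtype) :
    ∃ δ > 0, ∀ x y : orbitClosure η, dist x y < δ → x.1 0 = y.1 0 :=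
  @exists_forall_apply_zero_eq A _ _ _ instTopologicalSpaceSubtype (compactSpace_orbitClosure η) _
    continuous_subtype_val _ (continuous_dist_orbitClosure hd) fun _ _ => dist_pos.2

end Compactness

/-! ### Expansiveness in terms of windows -/

theorem toPlane_add (u v : ℤ × ℤ) : toPlane (u + v) = toPlane u + toPlane v := by
  ext i
  fin_cases i <;> simp [toPlane]

theorem toPlane_neg (u : ℤ × ℤ) : toPlane (-u) = -toPlane u := by
  ext i
  fin_cases i <;> simp [toPlane]

theorem toPlane_nsmul (n : ℕ) (u : ℤ × ℤ) : toPlane (n • u) = (n : ℝ) • toPlane u := by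
  ext i
  fin_cases i <;> simp [toPlane]

section Expansiveness

variable {A : Type*} [Finite A] [TopologicalSpace A] [DiscreteTopology A] {η : ℤ × ℤ → A}
  [d : MetricSpace (orbitClosure η)]

/-- Expansiveness of the line `ker θ` makes the half-plane `θ < 0` determine the origin: by
translating, the half-plane contains an arbitrarily wide strip around a parallel of `ker θ`. -/
theorem exists_determines_of_isExpansiveSubspace
    (hd : d.toPseudoMetricSpace.toUniformSpace.toTopologicalSpace = instTopologicalSpaceSubtype)
    {θ : EuclideanSpace ℝ (Fin 2) →L[ℝ] ℝ}
    (hexp : IsExpansiveSubspace (orbitClosureShift η) (LinearMap.ker θ.toLinearMap))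
    {v : ℤ × ℤ} (hv : 0 < θ (toPlane v)) :
    ∃ W : Finset (ℤ × ℤ), Determines η W ∧ ∀ w ∈ W, θ (toPlane w) < 0 := by
  obtain ⟨r, hr, δ, hδ, hexp⟩ := hexp
  obtain ⟨B, hB⟩ := exists_finset_dist_lt hd hδ
  refine exists_determines_of_forall_eq (H := {u | θ (toPlane u) < 0}) fun x hx y hy hxy => ?_
  obtain ⟨C, hC⟩ : ∃ C : ℝ, ∀ b ∈ B, θ (toPlane b) ≤ C := by
    obtain ⟨C, hC⟩ := (B.image fun b => θ (toPlane b)).bddAbove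
    exact ⟨C, fun b hb => hC (by simpa using ⟨b.1, b.2, hb, rfl⟩)⟩
  obtain ⟨k, hk⟩ := exists_nat_gt ((‖θ‖ * r + C) / θ (toPlane v))
  rw [div_lt_iff₀ hv] at hk
  -- Translating by `t` moves a strip around `ker θ`, thickened by `B`, into the half-plane.
  set t : ℤ × ℤ := -(k • v) with ht
  have hθt : θ (toPlane t) = -(k * θ (toPlane v)) := by
    rw [ht, toPlane_neg, toPlane_nsmul]
    simp
  have hstrip : ∀ u : ℤ × ℤ,
      Metric.infDist (toPlane u)
        (LinearMap.ker θ.toLinearMap : Set (EuclideanSpace ℝ (Fin 2))) < r →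
      θ (toPlane u) ≤ ‖θ‖ * r := by
    intro u hu
    obtain ⟨z, hz, hzr⟩ := (Metric.infDist_lt_iff ⟨0, Submodule.zero_mem _⟩).1 hu
    have hz0 : θ z = 0 := hz
    calc θ (toPlane u) = θ (toPlane u - z) := by rw [map_sub, hz0, sub_zero]
      _ ≤ ‖θ (toPlane u - z)‖ := Real.le_norm_self _
      _ ≤ ‖θ‖ * ‖toPlane u - z‖ := θ.le_opNorm _
      _ ≤ ‖θ‖ * r := by
        rw [← dist_eq_norm]
        exact mul_le_mul_of_nonneg_left hzr.le (norm_nonneg _)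
  have key : orbitClosureShift η t ⟨x, hx⟩ = orbitClosureShift η t ⟨y, hy⟩ := by
    refine hexp _ _ fun u hu => hB _ _ fun b hb => ?_
    change x (t + (u + b)) = y (t + (u + b))
    refine hxy _ ?_
    change θ (toPlane (t + (u + b))) < 0
    rw [toPlane_add, toPlane_add, map_add, map_add, hθt]
    linarith [hstrip u hu, hC b hb]
  have h0 : x (t + -t) = y (t + -t) := congrFun (congrArg Subtype.val key) (-t)
  simpa using h0

/-- Windows on both sides of `ker θ` let agreement on a strip spread to the whole plane. -/
theorem isExpansiveSubspace_of_determines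
    (hd : d.toPseudoMetricSpace.toUniformSpace.toTopologicalSpace = instTopologicalSpaceSubtype)
    {θ : EuclideanSpace ℝ (Fin 2) →L[ℝ] ℝ} (hθ : θ ≠ 0)
    {V : Submodule ℝ (EuclideanSpace ℝ (Fin 2))} (hV : LinearMap.ker θ.toLinearMap ≤ V)
    {W W' : Finset (ℤ × ℤ)} (hW : Determines η W) (hW' : Determines η W')
    (hneg : ∀ w ∈ W, θ (toPlane w) < 0) (hpos : ∀ w ∈ W', 0 < θ (toPlane w)) :
    IsExpansiveSubspace (orbitClosureShift η) V := by
  classical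
  obtain ⟨δ, hδ, hδ0⟩ := exists_dist_lt_apply_zero_eq hd
  obtain ⟨e, he⟩ : ∃ e, θ e = 1 := by
    obtain ⟨z, hz⟩ : ∃ z, θ z ≠ 0 := by
      by_contra! h
      exact hθ (ContinuousLinearMap.ext h)
    exact ⟨(θ z)⁻¹ • z, by simp [hz]⟩
  have hev : ∃ ρ μ : ℝ, 0 < μ ∧ ∀ w ∈ W ∪ W', μ ≤ |θ (toPlane w)| ∧ |θ (toPlane w)| ≤ ρ := by
    have hne : ∀ w ∈ W ∪ W', 0 < |θ (toPlane w)| := by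
      intro w hw
      rcases Finset.mem_union.1 hw with h | h
      · exact abs_pos.2 (hneg w h).ne
      · exact abs_pos.2 (hpos w h).ne'
    obtain ⟨ρ, hρ⟩ := ((W ∪ W').image fun w => |θ (toPlane w)|).bddAbove
    have hμ : ∀ᶠ μ in nhdsWithin (0 : ℝ) (Set.Ioi 0), ∀ w ∈ W ∪ W', μ ≤ |θ (toPlane w)| :=
      (Filter.eventually_all_finset _).2 fun w hw =>
        nhdsWithin_le_nhds ((eventually_lt_nhds (hne w hw)).mono fun _ h => h.le)
    obtain ⟨μ, h1, h2⟩ := (hμ.and self_mem_nhdsWithin).exists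
    exact ⟨ρ, μ, h2, fun w hw => ⟨h1 w hw, hρ (Finset.mem_coe.2 (Finset.mem_image_of_mem _ hw))⟩⟩
  obtain ⟨ρ₀, μ, hμ, hρ₀⟩ := hev
  set ρ := max ρ₀ 0 + 1 with hρdef
  have hρ : ∀ w ∈ W ∪ W', μ ≤ |θ (toPlane w)| ∧ |θ (toPlane w)| < ρ := fun w hw =>
    ⟨(hρ₀ w hw).1, ((hρ₀ w hw).2.trans (le_max_left _ _)).trans_lt (lt_add_one _)⟩
  have hρ1 : 0 < ρ := by positivity
  refine ⟨ρ * (‖e‖ + 1), by positivity, δ, hδ, fun x y hxy => Subtype.ext (funext fun u => ?_)⟩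
  -- Each step widens the strip of agreement by the margin `μ`.
  have hstrip : ∀ n : ℕ, ∀ u : ℤ × ℤ, |θ (toPlane u)| < ρ + n * μ → x.1 u = y.1 u := by
    intro n
    induction n with
    | zero =>
      intro u hu
      have hu' : |θ (toPlane u)| < ρ := by simpa using hu
      have hdist : Metric.infDist (toPlane u) (V : Set (EuclideanSpace ℝ (Fin 2)))
          < ρ * (‖e‖ + 1) := by
        have hmem : toPlane u - θ (toPlane u) • e ∈ V := hV (by simp [he])
        refine (Metric.infDist_le_dist_of_mem hmem).trans_lt ?_
        rw [dist_eq_norm, sub_sub_cancel, norm_smul, Real.norm_eq_abs]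
        have := mul_le_mul_of_nonneg_right hu'.le (norm_nonneg e)
        linarith
      have h0 : x.1 (u + 0) = y.1 (u + 0) := hδ0 _ _ (hxy u hdist)
      simpa using h0
    | succ n ih =>
      intro u hu
      push_cast at hu
      have hn : 0 ≤ n * μ := by positivity
      by_cases hsmall : |θ (toPlane u)| < ρ
      · exact ih u (by linarith)
      rw [not_lt] at hsmall
      rcases le_abs.1 hsmall with h | h
      · rw [abs_of_pos (by linarith)] at hu
        refine hW.apply_eq x.2 y.2 u fun w hw => ih _ ?_
        have h1 := hρ w (Finset.mem_union_left _ hw)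
        rw [abs_of_neg (hneg w hw)] at h1
        rw [toPlane_add, map_add, abs_lt]
        constructor <;> linarith
      · rw [abs_of_neg (by linarith)] at hu
        refine hW'.apply_eq x.2 y.2 u fun w hw => ih _ ?_
        have h1 := hρ w (Finset.mem_union_right _ hw)
        rw [abs_of_pos (hpos w hw)] at h1
        rw [toPlane_add, map_add, abs_lt]
        constructor <;> linarith
  obtain ⟨n, hn⟩ := exists_nat_gt (|θ (toPlane u)| / μ)
  rw [div_lt_iff₀ hμ] at hn
  exact hstrip n u (by linarith)

end Expansiveness

/-! ### Windows from low block complexity -/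

theorem rectangle_eq_coe (n k : ℕ) :
    rectangle n k = ((Finset.Ico (0 : ℤ) n ×ˢ Finset.Ico (0 : ℤ) k : Finset (ℤ × ℤ)) :
      Set (ℤ × ℤ)) := by
  ext p
  simp [rectangle, and_assoc]

/-- If there are at most as many `n × k` blocks as cells in the block, linear algebra gives a
nontrivial affine relation `∑ f s • η (u + s) = const` valid for all `u`, where symbols are encoded
as rational numbers. It can be solved for the symbol at any point of the support of `f`. -/
theorem exists_finset_determines_of_blockComplexity_le {A : Type*} [Finite A] {η : ℤ × ℤ → A}
    {n k : ℕ} (h : blockComplexity η n k ≤ n * k) :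
    ∃ S : Finset (ℤ × ℤ), S.Nonempty ∧
      ∀ a ∈ S, Determines η ((S.erase a).image fun s => s - a) := by
  classical
  obtain ⟨m, ⟨c⟩⟩ := Finite.exists_equiv_fin A
  let e : A → ℚ := fun a => ((c a : ℕ) : ℚ)
  have he : Function.Injective e := fun a b hab => by
    simpa [e, Fin.val_inj] using hab
  set R : Finset (ℤ × ℤ) := Finset.Ico (0 : ℤ) n ×ˢ Finset.Ico (0 : ℤ) k with hR
  have hRcard : R.card = n * k := by simp [hR]
  have hrect : rectangle n k = R := rectangle_eq_coe n k
  rw [blockComplexity, hrect] at h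
  have : Fintype (colorings η (R : Set (ℤ × ℤ))) := Fintype.ofFinite _
  let Φ : ((R → ℚ) × ℚ) →ₗ[ℚ] (colorings η (R : Set (ℤ × ℤ)) → ℚ) :=
    { toFun := fun p b => ∑ s : R, p.1 s * e (b.1 s) + p.2
      map_add' := fun p q => by
        ext b
        simp only [Prod.fst_add, Prod.snd_add, Pi.add_apply, add_mul, Finset.sum_add_distrib]
        ring
      map_smul' := fun r p => by
        ext b
        simp only [Prod.smul_fst, Prod.smul_snd, Pi.smul_apply, smul_eq_mul, RingHom.id_apply,
          mul_add, Finset.mul_sum, mul_assoc] }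
  have hker : LinearMap.ker Φ ≠ ⊥ := by
    refine LinearMap.ker_ne_bot_of_finrank_lt ?_
    rw [Module.finrank_prod, Module.finrank_fintype_fun_eq_card,
      Module.finrank_fintype_fun_eq_card, Module.finrank_self, Fintype.card_coe, hRcard,
      ← Nat.card_eq_fintype_card, Nat.card_coe_set_eq]
    omega
  obtain ⟨⟨f, K⟩, hfK, hne⟩ := (Submodule.ne_bot_iff _).1 hker
  have hrel : ∀ u : ℤ × ℤ, ∑ s : R, f s * e (η (u + s)) + K = 0 := fun u =>
    congrFun (LinearMap.mem_ker.1 hfK) ⟨_, u, rfl⟩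
  let g : ℤ × ℤ → ℚ := fun s => if hs : s ∈ R then f ⟨s, hs⟩ else 0
  have hgrel : ∀ u : ℤ × ℤ, ∑ s ∈ R, g s * e (η (u + s)) = -K := fun u => by
    have : ∑ s ∈ R, g s * e (η (u + s)) = ∑ s : R, f s * e (η (u + s)) := by
      rw [← Finset.sum_coe_sort R]
      exact Finset.sum_congr rfl fun s _ => by simp [g]
    linarith [hrel u]
  set S := R.filter fun s => g s ≠ 0 with hS
  have hSrel : ∀ u : ℤ × ℤ, ∑ s ∈ S, g s * e (η (u + s)) = -K := fun u => by
    rw [← hgrel u]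
    refine Finset.sum_subset (Finset.filter_subset _ _) fun s hs hs' => ?_
    have : g s = 0 := by simpa [hS, hs] using hs'
    simp [this]
  refine ⟨S, ?_, fun a ha u v huv => ?_⟩
  · by_contra hempty
    rw [Finset.not_nonempty_iff_eq_empty] at hempty
    have hK : K = 0 := by simpa [hempty] using hSrel 0
    refine hne (Prod.ext (funext fun s => ?_) hK)
    have : (s : ℤ × ℤ) ∉ S := by simp [hempty]
    simpa [hS, g] using this
  · have hu := hSrel (u - a)
    have hv := hSrel (v - a)
    rw [← Finset.add_sum_erase S _ ha] at hu hv
    have hsum : ∑ s ∈ S.erase a, g s * e (η (u - a + s))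
        = ∑ s ∈ S.erase a, g s * e (η (v - a + s)) := by
      refine Finset.sum_congr rfl fun s hs => ?_
      have := huv (s - a) (Finset.mem_image_of_mem _ hs)
      rw [show u - a + s = u + (s - a) by abel, show v - a + s = v + (s - a) by abel, this]
    have hga : g a ≠ 0 := (Finset.mem_filter.1 ha).2
    rw [sub_add_cancel] at hu hv
    exact he (mul_left_cancel₀ hga (by linarith))

/-! ### Periodicity from windows transverse to a rational line -/

/-- The coordinate `⟨v, u⟩` of `u`, up to scale the position of `u` in the direction `v`. -/
def along (v : ℤ × ℤ) : ℤ × ℤ →+ ℤ :=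
  v.1 • AddMonoidHom.fst ℤ ℤ + v.2 • AddMonoidHom.snd ℤ ℤ

/-- The coordinate `v × u` of `u`, up to scale and sign its distance to the line spanned by `v`. -/
def across (v : ℤ × ℤ) : ℤ × ℤ →+ ℤ :=
  v.2 • AddMonoidHom.fst ℤ ℤ - v.1 • AddMonoidHom.snd ℤ ℤ

theorem along_apply (v u : ℤ × ℤ) : along v u = v.1 * u.1 + v.2 * u.2 := by
  simp [along]

theorem across_apply (v u : ℤ × ℤ) : across v u = v.2 * u.1 - v.1 * u.2 := by
  simp [across]

theorem along_self_pos {v : ℤ × ℤ} (hv : v ≠ 0) : 0 < along v v := by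
  rw [along_apply]
  by_contra! h
  have h1 : v.1 = 0 := by nlinarith [sq_nonneg v.1, sq_nonneg v.2]
  have h2 : v.2 = 0 := by nlinarith [sq_nonneg v.1, sq_nonneg v.2]
  exact hv (Prod.ext h1 h2)

theorem across_self (v : ℤ × ℤ) : across v v = 0 := by
  rw [across_apply]; ring

theorem eq_zero_of_along_of_across {v u : ℤ × ℤ} (hv : v ≠ 0) (h1 : along v u = 0)
    (h2 : across v u = 0) : u = 0 := by
  have hpos := along_self_pos hv
  rw [along_apply] at h1 hpos
  rw [across_apply] at h2
  have e1 : (v.1 * v.1 + v.2 * v.2) * u.1 = 0 := by linear_combination v.1 * h1 + v.2 * h2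
  have e2 : (v.1 * v.1 + v.2 * v.2) * u.2 = 0 := by linear_combination v.2 * h1 - v.1 * h2
  exact Prod.ext ((mul_eq_zero.1 e1).resolve_left hpos.ne')
    ((mul_eq_zero.1 e2).resolve_left hpos.ne')

theorem finite_box {v : ℤ × ℤ} (hv : v ≠ 0) (h R : ℤ) :
    {k : ℤ × ℤ | |across v k| ≤ h ∧ -R ≤ along v k ∧ along v k < 0}.Finite := by
  refine Set.Finite.of_finite_image (f := fun k => (across v k, along v k))
    (((Set.finite_Icc (-h) h).prod (Set.finite_Ico (-R) 0)).subset ?_) ?_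
  · rintro _ ⟨k, ⟨h1, h2, h3⟩, rfl⟩
    exact ⟨abs_le.1 h1, h2, h3⟩
  · intro a _ b _ hab
    obtain ⟨h1, h2⟩ := Prod.mk.inj hab
    rw [← sub_eq_zero]
    exact eq_zero_of_along_of_across hv (by rw [map_sub, h2, sub_self])
      (by rw [map_sub, h1, sub_self])

section Strip

variable {A : Type*} {η : ℤ × ℤ → A}

/-- Solving a relation supported on `S` at the lexicographically largest point of `S`. -/
theorem exists_determines_lex {S : Finset (ℤ × ℤ)} (hS : S.Nonempty)
    (hdet : ∀ a ∈ S, Determines η ((S.erase a).image fun s => s - a)) {τ σ : ℤ × ℤ →+ ℤ}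
    (hinj : ∀ u, τ u = 0 → σ u = 0 → u = 0) :
    ∃ W : Finset (ℤ × ℤ), Determines η W ∧ ∀ w ∈ W, τ w < 0 ∨ τ w = 0 ∧ σ w < 0 := by
  obtain ⟨a, ha, hmax⟩ := S.exists_max_image (fun s => toLex (τ s, σ s)) hS
  refine ⟨_, hdet a ha, fun w hw => ?_⟩
  obtain ⟨s, hs, rfl⟩ := Finset.mem_image.1 hw
  obtain ⟨hsa, hs⟩ := Finset.mem_erase.1 hs
  have hne : ¬ (τ (s - a) = 0 ∧ σ (s - a) = 0) := fun h => hsa (sub_eq_zero.1 (hinj _ h.1 h.2))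
  rw [map_sub, map_sub] at hne ⊢
  rcases Prod.Lex.toLex_le_toLex.1 (hmax s hs) with h | ⟨h1, h2⟩
  · left; simp only at h; omega
  · right; simp only at h1 h2; omega

theorem exists_abs_le (W : Finset (ℤ × ℤ)) (σ : ℤ × ℤ →+ ℤ) : ∃ R : ℤ, ∀ w ∈ W, |σ w| ≤ R := by
  obtain ⟨R, hR⟩ := (W.image fun w => |σ w|).bddAbove
  exact ⟨R, fun w hw => hR (Finset.mem_coe.2 (Finset.mem_image_of_mem _ hw))⟩

/-- A window for the slope `t` serves all nearby slopes, so over a compact range of slopes the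
margins and the sizes of the windows can be chosen uniformly. -/
theorem exists_uniform_determines {σ τ : ℤ × ℤ →+ ℤ}
    (hslope : ∀ t : ℝ, ∃ W : Finset (ℤ × ℤ), Determines η W ∧ ∀ w ∈ W, (σ w : ℝ) + t * τ w < 0)
    (M : ℝ) :
    ∃ ε > (0 : ℝ), ∃ R : ℤ, ∀ t ∈ Set.Icc (-M) M, ∃ W : Finset (ℤ × ℤ), Determines η W ∧
      ∀ w ∈ W, (σ w : ℝ) + t * τ w ≤ -ε ∧ |σ w| ≤ R ∧ |τ w| ≤ R := by
  refine isCompact_Icc.induction_on (p := fun s : Set ℝ => ∃ ε > (0 : ℝ), ∃ R : ℤ, ∀ t ∈ s,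
    ∃ W : Finset (ℤ × ℤ), Determines η W ∧
      ∀ w ∈ W, (σ w : ℝ) + t * τ w ≤ -ε ∧ |σ w| ≤ R ∧ |τ w| ≤ R) ?_ ?_ ?_ ?_
  · exact ⟨1, one_pos, 0, fun t ht => ht.elim⟩
  · rintro s s' hss ⟨ε, hε, R, h⟩
    exact ⟨ε, hε, R, fun t ht => h t (hss ht)⟩
  · rintro s s' ⟨ε, hε, R, h⟩ ⟨ε', hε', R', h'⟩
    refine ⟨min ε ε', lt_min hε hε', max R R', ?_⟩
    rintro t (ht | ht)
    · obtain ⟨W, hW, hw⟩ := h t ht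
      exact ⟨W, hW, fun w hwW => ⟨(hw w hwW).1.trans (neg_le_neg (min_le_left _ _)),
        (hw w hwW).2.1.trans (le_max_left _ _), (hw w hwW).2.2.trans (le_max_left _ _)⟩⟩
    · obtain ⟨W, hW, hw⟩ := h' t ht
      exact ⟨W, hW, fun w hwW => ⟨(hw w hwW).1.trans (neg_le_neg (min_le_right _ _)),
        (hw w hwW).2.1.trans (le_max_right _ _), (hw w hwW).2.2.trans (le_max_right _ _)⟩⟩
  · intro t₀ _
    obtain ⟨W, hW, hneg⟩ := hslope t₀
    obtain ⟨R₁, hR₁⟩ := exists_abs_le W σ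
    obtain ⟨R₂, hR₂⟩ := exists_abs_le W τ
    have hε : ∀ᶠ ε in nhdsWithin (0 : ℝ) (Set.Ioi 0), ∀ w ∈ W, (σ w : ℝ) + t₀ * τ w < -ε :=
      (Filter.eventually_all_finset _).2 fun w hw => nhdsWithin_le_nhds
        ((eventually_lt_nhds (neg_pos.2 (hneg w hw))).mono fun _ h => by linarith)
    obtain ⟨ε, h1, h2⟩ := (hε.and self_mem_nhdsWithin).exists
    have hnear : ∀ᶠ t in nhds t₀, ∀ w ∈ W, (σ w : ℝ) + t * τ w < -ε :=
      (Filter.eventually_all_finset _).2 fun w hw =>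
        (show Continuous fun t : ℝ => (σ w : ℝ) + t * τ w by fun_prop).continuousAt.eventually_lt
          continuousAt_const (h1 w hw)
    refine ⟨_, nhdsWithin_le_nhds hnear, ε, h2, max R₁ R₂, fun t ht => ⟨W, hW, fun w hw => ?_⟩⟩
    exact ⟨(ht w hw).le, (hR₁ w hw).trans (le_max_left _ _), (hR₂ w hw).trans (le_max_right _ _)⟩

/-- In a strip `|τ| ≤ h` that is wide enough, every point has a window inside the strip on which the
function `N σ + τ ^ 2` is smaller than at the point: the curves `N σ + τ ^ 2 = const` are flat
enough for the windows of bounded slope, whose sizes are bounded, and close to the boundary of the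
strip their slope is so large that a lexicographic window, which does not leave the strip,
can be used. -/
theorem exists_strip_windows {σ τ : ℤ × ℤ →+ ℤ}
    (hslope : ∀ t : ℝ, ∃ W : Finset (ℤ × ℤ), Determines η W ∧ ∀ w ∈ W, (σ w : ℝ) + t * τ w < 0)
    (hbelow : ∃ W : Finset (ℤ × ℤ), Determines η W ∧ ∀ w ∈ W, τ w < 0 ∨ τ w = 0 ∧ σ w < 0)
    (habove : ∃ W : Finset (ℤ × ℤ), Determines η W ∧ ∀ w ∈ W, 0 < τ w ∨ τ w = 0 ∧ σ w < 0) :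
    ∃ N h R : ℤ, 0 < N ∧ 0 ≤ h ∧ ∀ p, |τ p| ≤ h → ∃ W : Finset (ℤ × ℤ), Determines η W ∧
      ∀ w ∈ W, |τ (p + w)| ≤ h ∧ -R ≤ σ w ∧
        N * σ (p + w) + τ (p + w) ^ 2 < N * σ p + τ p ^ 2 := by
  obtain ⟨W₁, hW₁, hlex₁⟩ := hbelow
  obtain ⟨W₂, hW₂, hlex₂⟩ := habove
  obtain ⟨R₀, hR₀pos, hR₁, hR₂⟩ : ∃ R₀ : ℤ, 0 ≤ R₀ ∧ (∀ w ∈ W₁, |σ w| ≤ R₀ ∧ |τ w| ≤ R₀) ∧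
      ∀ w ∈ W₂, |σ w| ≤ R₀ ∧ |τ w| ≤ R₀ := by
    classical
    obtain ⟨a, ha⟩ := exists_abs_le (W₁ ∪ W₂) σ
    obtain ⟨b, hb⟩ := exists_abs_le (W₁ ∪ W₂) τ
    refine ⟨max 0 (max a b), le_max_left _ _, fun w hw => ?_, fun w hw => ?_⟩
    · have := ha w (Finset.mem_union_left _ hw)
      have := hb w (Finset.mem_union_left _ hw)
      omega
    · have := ha w (Finset.mem_union_right _ hw)
      have := hb w (Finset.mem_union_right _ hw)
      omega
  obtain ⟨ε, hε, R', hunif⟩ := exists_uniform_determines hslope (2 * R₀)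
  obtain ⟨R, hRR', hR⟩ : ∃ R : ℤ, R' ≤ R ∧ R₀ ≤ R :=
    ⟨max R' R₀, le_max_left _ _, le_max_right _ _⟩
  obtain ⟨n, hn⟩ := exists_nat_gt ((R : ℝ) ^ 2 / ε)
  rw [div_lt_iff₀ hε] at hn
  have hn0 : 0 < (n : ℤ) + 1 := by positivity
  set N : ℤ := n + 1 with hN
  have hNε : (R : ℝ) ^ 2 < N * ε := by
    rw [hN]; push_cast; linarith
  have hNR : 0 ≤ N * R₀ := mul_nonneg hn0.le hR₀pos
  refine ⟨N, (N + 1) * R₀ + R, R, hn0, by linarith, fun p hp => ?_⟩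
  -- The gradient of `N σ + τ ^ 2` at `p` is that of `N (σ + t τ)` for `t = 2 τ p / N`,
  -- which is at most `2 R₀` in absolute value in the first case. In the second case it is large
  -- enough for a lexicographic window.
  by_cases hmid : 2 * |τ p| ≤ (N + 1) * R₀
  · have hNpos : (0 : ℝ) < N := by exact_mod_cast hn0
    obtain ⟨W, hW, hw⟩ := hunif (2 * τ p / N) (by
      rw [Set.mem_Icc, ← abs_le, abs_div, abs_of_pos hNpos, div_le_iff₀ hNpos, abs_mul, abs_two]
      have h1 : 2 * |τ p| ≤ 2 * R₀ * N := by nlinarith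
      exact_mod_cast h1)
    refine ⟨W, hW, fun w hwW => ?_⟩
    obtain ⟨h1, h2, h3⟩ := hw w hwW
    refine ⟨?_, ?_, ?_⟩
    · rw [map_add]
      have := abs_add_le (τ p) (τ w)
      have := abs_nonneg (τ p)
      linarith
    · have := (abs_le.1 h2).1
      linarith
    · have h4 : (N : ℝ) * σ w + 2 * τ p * τ w ≤ -(N * ε) := by
        have := mul_le_mul_of_nonneg_left h1 hNpos.le
        have e : (N : ℝ) * (σ w + 2 * τ p / N * τ w) = N * σ w + 2 * τ p * τ w := by
          field_simp
        linarith
      have h5 : (τ w : ℝ) ^ 2 ≤ (R : ℝ) ^ 2 := by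
        have : |τ w| ≤ R := h3.trans hRR'
        exact sq_le_sq' (by exact_mod_cast (abs_le.1 this).1) (by exact_mod_cast (abs_le.1 this).2)
      have h6 : (N : ℝ) * σ w + 2 * τ p * τ w + (τ w : ℝ) ^ 2 < 0 := by linarith
      have h7 : N * σ w + 2 * τ p * τ w + τ w ^ 2 < 0 := by exact_mod_cast h6
      rw [map_add, map_add]
      linarith
  · rw [not_le] at hmid
    rcases le_total 0 (τ p) with hs | hs
    · rw [abs_of_nonneg hs] at hmid hp
      refine ⟨W₁, hW₁, fun w hwW => ?_⟩
      obtain ⟨h2, h3⟩ := hR₁ w hwW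
      rw [abs_le] at h2 h3
      rw [map_add, map_add, abs_le]
      refine ⟨?_, by linarith, ?_⟩
      · rcases hlex₁ w hwW with h | ⟨h, -⟩ <;> constructor <;> linarith
      · rcases hlex₁ w hwW with h | ⟨h, h'⟩
        · have h4 : N * σ w ≤ N * R₀ := mul_le_mul_of_nonneg_left h2.2 hn0.le
          have h5 : 0 < 2 * τ p + τ w := by linarith
          have h6 : N * R₀ < 2 * τ p + τ w := by linarith
          nlinarith
        · rw [h]
          have := mul_pos hn0 (neg_pos.2 h')
          linarith
    · rw [abs_of_nonpos hs] at hmid hp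
      refine ⟨W₂, hW₂, fun w hwW => ?_⟩
      obtain ⟨h2, h3⟩ := hR₂ w hwW
      rw [abs_le] at h2 h3
      rw [map_add, map_add, abs_le]
      refine ⟨?_, by linarith, ?_⟩
      · rcases hlex₂ w hwW with h | ⟨h, -⟩ <;> constructor <;> linarith
      · rcases hlex₂ w hwW with h | ⟨h, h'⟩
        · have h4 : N * σ w ≤ N * R₀ := mul_le_mul_of_nonneg_left h2.2 hn0.le
          have h6 : N * R₀ < -(2 * τ p + τ w) := by linarith
          nlinarith
        · rw [h]
          have := mul_pos hn0 (neg_pos.2 h')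
          linarith

/-- A finite box in the strip determines the part of the strip to its right, by induction on
`N σ + τ ^ 2`. -/
theorem eq_of_eq_on_box {σ τ : ℤ × ℤ →+ ℤ} {N h R : ℤ} (hN : 0 < N)
    (hwin : ∀ p, |τ p| ≤ h → ∃ W : Finset (ℤ × ℤ), Determines η W ∧
      ∀ w ∈ W, |τ (p + w)| ≤ h ∧ -R ≤ σ w ∧
        N * σ (p + w) + τ (p + w) ^ 2 < N * σ p + τ p ^ 2)
    {u v : ℤ × ℤ}
    (huv : ∀ k, |τ k| ≤ h → -R ≤ σ k → σ k < 0 → η (u + k) = η (v + k))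
    (p : ℤ × ℤ) (hp : |τ p| ≤ h) (hσ : 0 ≤ σ p) : η (u + p) = η (v + p) := by
  induction hm : (N * σ p + τ p ^ 2).toNat using Nat.strong_induction_on generalizing p with
  | _ m ih =>
    obtain ⟨W, hW, hw⟩ := hwin p hp
    refine hW _ _ fun w hwW => ?_
    obtain ⟨h1, h2, h3⟩ := hw w hwW
    rw [add_assoc, add_assoc]
    by_cases hneg : σ (p + w) < 0
    · exact huv _ h1 (by rw [map_add]; linarith) hneg
    · rw [not_lt] at hneg
      refine ih _ ?_ _ h1 hneg rfl
      have : 0 ≤ N * σ (p + w) + τ (p + w) ^ 2 := by positivity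
      omega

/-- The pattern in a moving finite box evolves deterministically in the direction `v`. Since there
are boundedly many patterns, `η` is periodic in the direction `v`. -/
theorem isPeriodic_of_windows [Finite A] {v : ℤ × ℤ} (hv : v ≠ 0)
    (hslope : ∀ t : ℝ, ∃ W : Finset (ℤ × ℤ), Determines η W ∧
      ∀ w ∈ W, (along v w : ℝ) + t * across v w < 0)
    {S : Finset (ℤ × ℤ)} (hS : S.Nonempty)
    (hdet : ∀ a ∈ S, Determines η ((S.erase a).image fun s => s - a)) :
    IsPeriodic η := by
  obtain ⟨N, h, R, hN, hh, hwin⟩ := exists_strip_windows hslope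
    (exists_determines_lex hS hdet fun u h1 h2 => eq_zero_of_along_of_across hv h2 h1)
    (by
      obtain ⟨W, hW, hw⟩ := exists_determines_lex (τ := -across v) (σ := along v) hS hdet
        fun u h1 h2 => eq_zero_of_along_of_across hv h2 (by simpa using h1)
      exact ⟨W, hW, fun w hwW => by simpa using hw w hwW⟩)
  -- `K` is the box whose patterns are the states of the deterministic evolution, and `M` is the
  -- number of states. Both are independent of the base point `u` below.
  set K : Set (ℤ × ℤ) := {k | |across v k| ≤ h ∧ -R ≤ along v k ∧ along v k < 0}
  have : Finite K := finite_box hv h R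
  set M := Nat.card (K → A)
  have hvpos := along_self_pos hv
  have hperiod : ∀ u : ℤ × ℤ, η (u + (M + M.factorial) • v) = η (u + M • v) := by
    intro u
    obtain ⟨i, j, hij, heq⟩ : ∃ i j : Fin (M + 1), i < j ∧
        (fun k : K => η (u + (i : ℕ) • v + k)) = fun k : K => η (u + (j : ℕ) • v + k) := by
      have hnot : ¬ Function.Injective fun (i : Fin (M + 1)) (k : K) => η (u + (i : ℕ) • v + k) :=
        fun hinj => by
          have := Nat.card_le_card_of_injective _ hinj
          simp only [Nat.card_eq_fintype_card, Fintype.card_fin] at this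
          omega
      simp only [Function.Injective, not_forall] at hnot
      obtain ⟨i, j, heq, hne⟩ := hnot
      rcases lt_or_gt_of_ne hne with hlt | hlt
      · exact ⟨i, j, hlt, heq⟩
      · exact ⟨j, i, hlt, heq.symm⟩
    have hijN : (i : ℕ) < j := hij
    have hjM : (j : ℕ) ≤ M := Nat.lt_succ_iff.1 j.2
    have hstep : ∀ k : ℕ, η (u + (i + k : ℕ) • v) = η (u + (j + k : ℕ) • v) := by
      intro k
      have := eq_of_eq_on_box hN hwin (u := u + (i : ℕ) • v) (v := u + (j : ℕ) • v)
        (fun q h1 h2 h3 => congrFun heq ⟨q, h1, h2, h3⟩) (k • v)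
        (by rw [map_nsmul, across_self, smul_zero, abs_zero]; exact hh)
        (by rw [map_nsmul]; exact nsmul_nonneg hvpos.le k)
      rwa [add_assoc, add_assoc, ← add_nsmul, ← add_nsmul] at this
    have hmult : ∀ c k : ℕ, (i : ℕ) ≤ k → η (u + (k + (j - i) * c) • v) = η (u + k • v) := by
      intro c
      induction c with
      | zero => intro k _; simp
      | succ c ih =>
        intro k hk
        rw [show k + (j - i : ℕ) * (c + 1) = j + (k - i + (j - i) * c) by
          rw [Nat.mul_succ]; omega, ← hstep,
          show (i : ℕ) + (k - i + (j - i) * c) = k + (j - i) * c by omega]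
        exact ih k hk
    obtain ⟨c, hc⟩ : (j - i : ℕ) ∣ M.factorial :=
      Nat.dvd_factorial (by omega) (by omega)
    rw [hc]
    exact hmult c M (by omega)
  refine ⟨M.factorial • v, ?_, fun u => ?_⟩
  · intro h0
    have := congrArg (along v) h0
    rw [map_nsmul, map_zero, nsmul_eq_mul] at this
    have hpos : 0 < (M.factorial : ℤ) * along v v :=
      mul_pos (by exact_mod_cast M.factorial_pos) hvpos
    omega
  · -- The pre-period is at most `M` from every base point, so starting at `u - M • v` removes it.
    have := hperiod (u - M • v)
    rwa [add_nsmul, ← add_assoc, sub_add_cancel] at this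

end Strip

/-! ### Lines in the plane and the conclusion -/

/-- The linear form `(x, y) ↦ a x + b y` on the plane. -/
noncomputable def planeForm (a b : ℝ) : EuclideanSpace ℝ (Fin 2) →L[ℝ] ℝ :=
  a • EuclideanSpace.proj 0 + b • EuclideanSpace.proj 1

theorem planeForm_apply (a b : ℝ) (x : EuclideanSpace ℝ (Fin 2)) :
    planeForm a b x = a * x 0 + b * x 1 := by
  simp [planeForm]

theorem planeForm_toPlane (a b : ℝ) (u : ℤ × ℤ) :
    planeForm a b (toPlane u) = a * u.1 + b * u.2 := by
  simp [planeForm_apply, toPlane]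

theorem mem_span_of_planeForm_eq_zero {x w : EuclideanSpace ℝ (Fin 2)} (hw : w ≠ 0)
    (h : planeForm (w 1) (-(w 0)) x = 0) : x ∈ Submodule.span ℝ {w} := by
  rw [planeForm_apply] at h
  have hpos : w 0 * w 0 + w 1 * w 1 ≠ 0 := fun h0 => hw <| by
    have h1 : w 0 = 0 := by nlinarith [sq_nonneg (w 0), sq_nonneg (w 1)]
    have h2 : w 1 = 0 := by nlinarith [sq_nonneg (w 0), sq_nonneg (w 1)]
    ext i
    fin_cases i <;> simpa
  refine Submodule.mem_span_singleton.2 ⟨(w 0 * x 0 + w 1 * x 1) / (w 0 * w 0 + w 1 * w 1), ?_⟩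
  ext i
  fin_cases i
  · simp only [Fin.zero_eta, PiLp.smul_apply, smul_eq_mul]
    rw [div_mul_eq_mul_div, div_eq_iff hpos]
    linear_combination -(w 1) * h
  · simp only [Fin.mk_one, PiLp.smul_apply, smul_eq_mul]
    rw [div_mul_eq_mul_div, div_eq_iff hpos]
    linear_combination (w 0) * h

theorem toPlane_ne_zero {v : ℤ × ℤ} (hv : v ≠ 0) : toPlane v ≠ 0 := fun h => hv <| by
  have h0 : toPlane v 0 = 0 := by rw [h]; rfl
  have h1 : toPlane v 1 = 0 := by rw [h]; rfl
  exact Prod.ext (by simpa [toPlane] using h0) (by simpa [toPlane] using h1)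

theorem across_eq_zero_of_mem_span {v m : ℤ × ℤ} (h : toPlane m ∈ Submodule.span ℝ {toPlane v}) :
    across v m = 0 := by
  obtain ⟨c, hc⟩ := Submodule.mem_span_singleton.1 h
  have h0 : c * v.1 = m.1 := by simpa [toPlane] using congrArg (fun x => x 0) hc
  have h1 : c * v.2 = m.2 := by simpa [toPlane] using congrArg (fun x => x 1) hc
  have : ((v.2 * m.1 - v.1 * m.2 : ℤ) : ℝ) = 0 := by
    push_cast
    rw [← h0, ← h1]
    ring
  rw [across_apply]
  exact_mod_cast this

/-- A line is the kernel of a linear form; only one inclusion is needed. -/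
theorem exists_ker_le_of_finrank_eq_one {L : Submodule ℝ (EuclideanSpace ℝ (Fin 2))}
    (hL : Module.finrank ℝ L = 1) :
    ∃ θ : EuclideanSpace ℝ (Fin 2) →L[ℝ] ℝ, θ ≠ 0 ∧ LinearMap.ker θ.toLinearMap ≤ L := by
  obtain ⟨⟨w, hwL⟩, hw, -⟩ := finrank_eq_one_iff'.1 hL
  have hw' : w ≠ 0 := fun h => hw (Subtype.ext h)
  refine ⟨planeForm (w 1) (-(w 0)), fun h0 => hw' ?_, fun x hx => ?_⟩
  · have h1 := congrArg (fun θ => θ (toPlane (1, 0))) h0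
    have h2 := congrArg (fun θ => θ (toPlane (0, 1))) h0
    simp only [planeForm_toPlane] at h1 h2
    ext i
    fin_cases i
    · simpa using h2
    · simpa using h1
  · exact (Submodule.span_singleton_le_iff_mem _ _).2 hwL
      (mem_span_of_planeForm_eq_zero hw' hx)

theorem eq_span_of_mem {L : Submodule ℝ (EuclideanSpace ℝ (Fin 2))}
    (hL : Module.finrank ℝ L = 1) {x : EuclideanSpace ℝ (Fin 2)} (hx : x ∈ L) (hx0 : x ≠ 0) :
    L = Submodule.span ℝ {x} := by
  refine (Submodule.eq_of_le_of_finrank_eq ((Submodule.span_singleton_le_iff_mem _ _).2 hx) ?_).symm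
  rw [finrank_span_singleton hx0, hL]

theorem IsPeriodVector.neg {A : Type*} {η : ℤ × ℤ → A} {m : ℤ × ℤ} (hm : IsPeriodVector η m) :
    IsPeriodVector η (-m) := fun u => by
  have := hm (u + -m)
  rw [neg_add_cancel_right] at this
  exact this.symm

theorem IsPeriodVector.determines {A : Type*} {η : ℤ × ℤ → A} {m : ℤ × ℤ}
    (hm : IsPeriodVector η m) : Determines η {m} := fun u v h => by
  have := h m (Finset.mem_singleton_self m)
  rwa [hm u, hm v] at this

/-- A linear form that is injective on `S` is negative on the window at its maximum point. -/
theorem exists_determines_neg_of_injOn {A : Type*} {η : ℤ × ℤ → A} {S : Finset (ℤ × ℤ)}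
    (hS : S.Nonempty)
    (hdet : ∀ a ∈ S, Determines η ((S.erase a).image fun s => s - a))
    {θ : EuclideanSpace ℝ (Fin 2) →L[ℝ] ℝ} (hinj : Set.InjOn (fun s => θ (toPlane s)) S) :
    ∃ W : Finset (ℤ × ℤ), Determines η W ∧ ∀ w ∈ W, θ (toPlane w) < 0 := by
  obtain ⟨a, ha, hmax⟩ := S.exists_max_image (fun s => θ (toPlane s)) hS
  refine ⟨_, hdet a ha, fun w hw => ?_⟩
  obtain ⟨s, hs, rfl⟩ := Finset.mem_image.1 hw
  obtain ⟨hsa, hs⟩ := Finset.mem_erase.1 hs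
  have hlt := lt_of_le_of_ne (hmax s hs) fun h => hsa (hinj hs ha h)
  rw [sub_eq_add_neg, toPlane_add, toPlane_neg, map_add, map_neg]
  linarith

/-- The metric on `X_η` is an arbitrary one that induces its topology as a subspace of `A^(ℤ²)`. -/
theorem theorem1p3 {A : Type*} [Finite A] [TopologicalSpace A] [DiscreteTopology A]
    (η : ℤ × ℤ → A)
    [d : MetricSpace (orbitClosure η)]
    (hd : d.toPseudoMetricSpace.toUniformSpace.toTopologicalSpace = instTopologicalSpaceSubtype)
    (hP : ∃ n k : ℕ, 1 ≤ n ∧ 1 ≤ k ∧ blockComplexity η n k ≤ n * k)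
    (L : Submodule ℝ (EuclideanSpace ℝ (Fin 2)))
    (hL : IsNonexpansiveLine (orbitClosureShift η) L)
    (hunique : ∀ L' : Submodule ℝ (EuclideanSpace ℝ (Fin 2)),
      IsNonexpansiveLine (orbitClosureShift η) L' → L' = L) :
    IsPeriodic η ∧ ¬ IsDoublyPeriodic η ∧ IsRationalLine L ∧
      ∀ m : ℤ × ℤ, IsPeriodVector η m → toPlane m ∈ L := by
  obtain ⟨n, k, -, -, hnk⟩ := hP
  obtain ⟨S, hS, hdet⟩ := exists_finset_determines_of_blockComplexity_le hnk
  obtain ⟨hL1, hLne⟩ := hL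
  obtain ⟨θ, hθ, hker⟩ := exists_ker_le_of_finrank_eq_one hL1
  obtain ⟨v, hv, hvL⟩ : ∃ v : ℤ × ℤ, v ≠ 0 ∧ toPlane v ∈ L := by
    by_contra! hcon
    have hinj : Set.InjOn (fun s => θ (toPlane s)) S := fun s _ s' _ h => by
      by_contra hne
      refine hcon (s - s') (sub_ne_zero.2 hne) (hker ?_)
      have h' : θ (toPlane s) = θ (toPlane s') := h
      change θ (toPlane (s - s')) = 0
      rw [sub_eq_add_neg, toPlane_add, toPlane_neg, map_add, map_neg, h', add_neg_cancel]
    obtain ⟨W, hW, hneg⟩ := exists_determines_neg_of_injOn hS hdet hinj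
    obtain ⟨W', hW', hpos⟩ := exists_determines_neg_of_injOn (θ := -θ) hS hdet
      fun s hs s' hs' h => hinj hs hs' (by simpa using h)
    exact hLne (isExpansiveSubspace_of_determines hd hθ hker hW hW' hneg
      fun w hw => by simpa using hpos w hw)
  have hspan := eq_span_of_mem hL1 hvL (toPlane_ne_zero hv)
  have hperiods : ∀ m : ℤ × ℤ, IsPeriodVector η m → toPlane m ∈ L := by
    intro m hm
    by_contra hmL
    have hθm : θ (toPlane m) ≠ 0 := fun h => hmL (hker h)
    rcases lt_or_gt_of_ne hθm with h | h
    · exact hLne (isExpansiveSubspace_of_determines hd hθ hker hm.determines hm.neg.determines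
        (by simpa using h) (by simpa [toPlane_neg] using h))
    · exact hLne (isExpansiveSubspace_of_determines hd hθ hker hm.neg.determines hm.determines
        (by simpa [toPlane_neg] using h) (by simpa using h))
  refine ⟨?_, ?_, ⟨v, hv, hspan⟩, hperiods⟩
  · refine isPeriodic_of_windows hv (fun t => ?_) hS hdet
    -- The form `along v + t * across v` is positive at `v`, so its kernel is not `L`.
    set φ := planeForm (v.1 + t * v.2) (v.2 - t * v.1) with hφ
    have hφu : ∀ u : ℤ × ℤ, φ (toPlane u) = along v u + t * across v u := fun u => by
      rw [hφ, planeForm_toPlane, along_apply, across_apply]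
      push_cast
      ring
    have hφv : 0 < φ (toPlane v) := by
      rw [hφu, across_self]
      simpa using along_self_pos hv
    have hexp : IsExpansiveSubspace (orbitClosureShift η) (LinearMap.ker φ.toLinearMap) := by
      -- Otherwise `ker φ` would be a second nonexpansive line.
      by_contra hne
      have hφ0 : φ.toLinearMap ≠ 0 := fun h0 => hφv.ne' (LinearMap.congr_fun h0 _)
      have hrank := Module.Dual.finrank_ker_add_one_of_ne_zero (f := φ.toLinearMap) hφ0
      rw [finrank_euclideanSpace_fin] at hrank
      have := hunique _ ⟨by omega, hne⟩
      rw [← this] at hvL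
      exact hφv.ne' hvL
    obtain ⟨W, hW, hneg⟩ := exists_determines_of_isExpansiveSubspace hd hexp hφv
    exact ⟨W, hW, fun w hw => hφu w ▸ hneg w hw⟩
  · rintro ⟨m₁, m₂, h₁, h₂, hind⟩
    have ha₁ := across_eq_zero_of_mem_span (hspan ▸ hperiods m₁ h₁)
    have ha₂ := across_eq_zero_of_mem_span (hspan ▸ hperiods m₂ h₂)
    have hrel : along v m₂ • m₁ + (-along v m₁) • m₂ = 0 :=
      eq_zero_of_along_of_across hv (by
        rw [map_add, map_zsmul, map_zsmul, smul_eq_mul, smul_eq_mul]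
        ring)
      (by rw [map_add, map_zsmul, map_zsmul, ha₁, ha₂, smul_zero, smul_zero, add_zero])
    have h0 := (LinearIndependent.pair_iff.1 hind _ _ hrel).1
    exact hind.ne_zero 1 (eq_zero_of_along_of_across hv h0 ha₂)
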